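/- Let $k$ be an algebraically closed field and let $\mathcal C$ be a $k$-linear triangulated category with suspension functor $S$ which is Krull–Schmidt, has split idempotents and finite-dimensional Hom-spaces. Write $D=\operatorname{Hom}_k(-,k)$ and $\operatorname{Ext}^n_{\mathcal C}(X,Y)=\operatorname{Hom}_{\mathcal C}(X,S^nY)$; for an object $X$, let $\operatorname{add}X$ be the full subcategory of direct factors of finite direct sums of copies of $X$. Assume that $\mathcal C$ is $2$-Calabi–Yau, i.e. it has a Serre functor $\Sigma$ (a $k$-linear autoequivalence with isomorphisms $\operatorname{Hom}_{\mathcal C}(X,Y)\simeq D\operatorname{Hom}_{\mathcal C}(Y,\Sigma X)$ natural in $X$ and $Y$), and $\Sigma\simeq S^2$. Let $T$ be a cluster-tilting object of $\mathcal C$, i.e. $\operatorname{Ext}^1_{\mathcal C}(T,T)=0$ and every $X\in\mathcal C$ with $\operatorname{Hom}_{\mathcal C}(X,ST)=0$ lies in $\operatorname{add}T$. Let $\Gamma=\operatorname{End}_{\mathcal C}(T)$ and let $F=\operatorname{Hom}_{\mathcal C}(T,-)$, with values in finite-dimensional right $\Gamma$-modules. Let $M,N$ be objects of $\mathcal C$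 without nonzero direct summands in $\operatorname{add}ST$. If $FM$ and $FN$ have projective dimension at most one over $\Gamma$, and $\operatorname{Ext}^1_\Gamma(FM,FN)=0$ and $\operatorname{Ext}^1_\Gamma(FN,FM)=0$, then $\operatorname{Ext}^1_{\mathcal C}(M,N)=0$ and $\operatorname{Ext}^1_{\mathcal C}(N,M)=0$. -/

import Mathlib

open CategoryTheory CategoryTheory.Limits CategoryTheory.Pretriangulated

universe w v u

namespace TwoCY

/-- A category is Krull-Schmidt if every object is a finite direct sum of objects
with local endomorphism rings. -/
def IsKrullSchmidt (C : Type u) [Category.{v} C] [Preadditive C] [HasFiniteBiproducts C] : Prop :=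
  ∀ X : C, ∃ (n : ℕ) (Y : Fin n → C),
    (∀ i, IsLocalRing (End (Y i))) ∧ Nonempty (X ≅ ⨁ Y)

/-- All Hom-spaces are finite-dimensional over `k`. -/
def IsHomFinite (k : Type w) [Field k] (C : Type u) [Category.{v} C] [Preadditive C]
    [Linear k C] : Prop :=
  ∀ X Y : C, Module.Finite k (X ⟶ Y)

/-- A Serre functor of a `k`-linear category: a `k`-linear autoequivalence `Σ` with
`k`-linear isomorphisms `Hom(X, Y) ≅ D Hom(Y, Σ X)`, natural in `X` and in `Y`. -/
structure SerreFunctor (k : Type w) [Field k] (C : Type u) [Category.{v} C] [Preadditive C]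
    [Linear k C] where
  /-- the underlying functor -/
  functor : C ⥤ C
  additive : functor.Additive
  linear : functor.Linear k
  isEquivalence : functor.IsEquivalence
  /-- the duality isomorphisms -/
  duality (X Y : C) : (X ⟶ Y) ≃ₗ[k] Module.Dual k (Y ⟶ functor.obj X)
  naturality {X X' Y Y' : C} (f : X' ⟶ X) (g : Y ⟶ Y') (h : X ⟶ Y) (u : Y' ⟶ functor.obj X') :
    duality X' Y' (f ≫ h ≫ g) u = duality X Y h (g ≫ u ≫ functor.map f)

/-- `C` is Calabi-Yau of dimension 2: it has a Serre functor, and the latter is isomorphic to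
the square of the suspension functor. (Only an isomorphism of the underlying functors is
required, which is the weaker assumption.) -/
def IsTwoCalabiYau (k : Type w) [Field k] (C : Type u) [Category.{v} C] [Preadditive C]
    [Linear k C] [HasShift C ℤ] : Prop :=
  ∃ S : SerreFunctor k C, Nonempty (shiftFunctor C (2 : ℤ) ≅ S.functor)

section

variable {C : Type u} [Category.{v} C] [Preadditive C] [HasFiniteBiproducts C]

/-- `X` lies in `add T`: it is a direct factor of a finite direct sum of copies of `T`. -/
def InAdd (T X : C) : Prop :=
  ∃ n : ℕ, Nonempty (Retract X (⨁ fun _ : Fin n => T))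

/-- The only direct factor of `X` that lies in `add T` is zero. -/
def HasNoSummandInAdd (T X : C) : Prop :=
  ∀ Y : C, Nonempty (Retract Y X) → InAdd T Y → IsZero Y

/-- `T` is a cluster-tilting object: `Ext¹(T, T) = 0`, and every `X` with `Hom(X, ST) = 0`
belongs to `add T`. -/
structure IsClusterTilting [HasShift C ℤ] (T : C) : Prop where
  rigid : Subsingleton (ShiftedHom T T (1 : ℤ))
  mem_add (X : C) : Subsingleton (X ⟶ T⟦(1 : ℤ)⟧) → InAdd T X

end

end TwoCY

namespace TwoCY

/-! ### Hom(T, -) on add T -/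

section Add

variable {C : Type u} [Category.{v} C] [Preadditive C] [HasFiniteBiproducts C]

/-! Take a triangle T₁ → T₀ → M → ST₁ with T₁, T₀ in add T. As FM has projective dimension at most
one, the kernel of FT₁ → FT₀ splits off; it comes from a summand T' of T₁, and ST' is then a summand
of M, hence zero. So 0 → FT₁ → FT₀ → FM → 0 is exact (`IsClusterTilting.shortExact`). Now Ext¹(FM,
FN) = 0 extends every T₁ → N along T₁ → T₀, so maps M → SN through add ST vanish
(`IsClusterTilting.comp_shift_map_eq_zero`). For any M → SN, Serre duality pairs T₀ → M → SN with
composites N → ST₀ → SM, which vanish by symmetry. Hence M → SN factors through ST₁ and is zero. -/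

lemma inAdd_biproduct (T : C) (n : ℕ) : InAdd T (⨁ fun _ : Fin n => T) :=
  ⟨n, ⟨Retract.refl _⟩⟩

lemma inAdd_self (T : C) : InAdd T T :=
  ⟨1, ⟨⟨biproduct.ι (fun _ : Fin 1 => T) 0, biproduct.π _ 0, biproduct.ι_π_self _ _⟩⟩⟩

lemma InAdd.of_retract {T X Y : C} (hX : InAdd T X) (r : Retract Y X) : InAdd T Y := by
  obtain ⟨n, ⟨s⟩⟩ := hX
  exact ⟨n, ⟨r.trans s⟩⟩

lemma InAdd.map {D : Type*} [Category* D] [Preadditive D] [HasFiniteBiproducts D]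
    (G : C ⥤ D) [G.Additive] {T X : C} (hX : InAdd T X) : InAdd (G.obj T) (G.obj X) := by
  obtain ⟨n, ⟨s⟩⟩ := hX
  exact ⟨n, ⟨(s.map G).trans (Retract.ofIso (G.mapBiproduct fun _ : Fin n => T))⟩⟩

lemma InAdd.hom_ext_from {T X Y : C} (hX : InAdd T X) {f g : X ⟶ Y}
    (h : ∀ x : T ⟶ X, x ≫ f = x ≫ g) : f = g := by
  obtain ⟨n, ⟨s⟩⟩ := hX
  have : s.r ≫ f = s.r ≫ g := by
    ext j
    simpa using h (biproduct.ι (fun _ : Fin n => T) j ≫ s.r)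
  rw [← Category.id_comp f, ← s.retract, Category.assoc, this, s.retract_assoc]

lemma InAdd.eq_zero_of_comp_eq_zero {T X Z : C} (hX : InAdd T X) {f : Z ⟶ X}
    (h : ∀ y : X ⟶ T, f ≫ y = 0) : f = 0 := by
  obtain ⟨n, ⟨s⟩⟩ := hX
  have : f ≫ s.i = 0 := by
    ext j
    simpa using h (s.i ≫ biproduct.π (fun _ : Fin n => T) j)
  rw [← Category.comp_id f, ← s.retract, reassoc_of% this, zero_comp]

lemma InAdd.projective {T X : C} (hX : InAdd T X) [Projective T] : Projective X := by
  obtain ⟨n, ⟨s⟩⟩ := hX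
  have : Projective (⨁ fun _ : Fin n => T) :=
    ⟨fun φ e _ => ⟨biproduct.desc fun j => Projective.factorThru
      (biproduct.ι (fun _ : Fin n => T) j ≫ φ) e,
      by ext; simp⟩⟩
  exact s.projective

lemma InAdd.preadditiveCoyonedaObj_map_injective {T X Y : C} (hX : InAdd T X) :
    Function.Injective ((preadditiveCoyonedaObj T).map : (X ⟶ Y) → _) := fun _ _ h =>
  hX.hom_ext_from fun x => ConcreteCategory.congr_hom h x

/-- A Γ-linear map out of FT is determined by the image of the identity; sums and retracts extend
this to add T. -/
lemma InAdd.preadditiveCoyonedaObj_map_surjective {T X Y : C} (hX : InAdd T X) :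
    Function.Surjective ((preadditiveCoyonedaObj T).map : (X ⟶ Y) → _) := by
  intro φ
  obtain ⟨n, ⟨s⟩⟩ := hX
  let φ' : (T ⟶ X) →+ (T ⟶ Y) := φ.hom.toAddMonoidHom
  have hφ' (a : T ⟶ T) (x : T ⟶ X) : φ' (a ≫ x) = a ≫ φ' x :=
    φ.hom.map_smul (MulOpposite.op (a : End T)) x
  refine ⟨s.i ≫ biproduct.desc fun j => φ' (biproduct.ι (fun _ : Fin n => T) j ≫ s.r), ?_⟩
  ext (x : T ⟶ X)
  change x ≫ s.i ≫ biproduct.desc _ = φ' x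
  have hx : x = ∑ j, (x ≫ s.i ≫ biproduct.π (fun _ : Fin n => T) j) ≫
      biproduct.ι (fun _ : Fin n => T) j ≫ s.r := by
    conv_lhs => rw [← Category.comp_id x, ← s.retract, ← Category.id_comp s.r, ← biproduct.total]
    simp only [Preadditive.sum_comp, Preadditive.comp_sum, Category.assoc]
  conv_rhs => rw [hx]
  simp only [map_sum, hφ']
  simp [biproduct.desc_eq, Preadditive.comp_sum]

end Add

instance projective_preadditiveCoyonedaObj_self {C : Type u} [Category.{v} C] [Preadditive C]
    (T : C) : Projective ((preadditiveCoyonedaObj T).obj T) where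
  factors {E B} φ e _ := by
    obtain ⟨y, hy⟩ := (ModuleCat.epi_iff_surjective e).1 inferInstance
      (φ.hom (𝟙 T : T ⟶ T))
    let ψ : (preadditiveCoyonedaObj T).obj T →ₗ[(End T)ᵐᵒᵖ] E :=
      { toFun := fun x => (MulOpposite.op x : (End T)ᵐᵒᵖ) • y
        map_add' := fun a b =>
          add_smul (MulOpposite.op a : (End T)ᵐᵒᵖ) (MulOpposite.op b : (End T)ᵐᵒᵖ) y
        map_smul' := fun a b => mul_smul a (MulOpposite.op b : (End T)ᵐᵒᵖ) y }
    refine ⟨ModuleCat.ofHom ψ, ModuleCat.hom_ext (LinearMap.ext fun (x : T ⟶ T) => ?_)⟩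
    change e.hom (MulOpposite.op (x : End T) • y) = φ.hom x
    rw [map_smul]
    refine (congrArg _ hy).trans ?_
    refine (φ.hom.map_smul (MulOpposite.op (x : End T)) (𝟙 T : T ⟶ T)).symm.trans ?_
    exact congrArg φ.hom (Category.comp_id x)

/-! ### Projective dimension one and extensions -/

section Abelian

variable {A : Type*} [Category* A] [Abelian A]

/-- If `P₁ ⟶ P₀ ⟶ Q ⟶ 0` is exact, `P₀` is projective and `Q` has projective dimension at most
one, the kernel of `P₁ ⟶ P₀` is the image of an idempotent of `P₁`. -/
lemma exists_idempotent_of_hasProjectiveDimensionLE_one (S : ShortComplex A) (hS : S.Exact)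
    [Epi S.g] [Projective S.X₂] (hQ : HasProjectiveDimensionLE S.X₃ 1) :
    ∃ e : S.X₁ ⟶ S.X₁, e ≫ e = e ∧ e ≫ S.f = 0 ∧ (e = 0 → Mono S.f) := by
  have hK : (ShortComplex.mk (kernel.ι S.g) S.g (kernel.condition _)).ShortExact :=
    { exact := ShortComplex.exact_kernel S.g }
  have : Projective (kernel S.g) := by
    have := hK.hasProjectiveDimensionLT_X₁ (n := 1) (inferInstanceAs
      (HasProjectiveDimensionLT S.X₂ 1)) hQ
    exact inferInstanceAs (Projective (ShortComplex.mk (kernel.ι S.g) S.g _).X₁)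
  let q : S.X₁ ⟶ kernel S.g := kernel.lift S.g S.f S.zero
  have hq : q ≫ kernel.ι S.g = S.f := kernel.lift_ι _ _ _
  have : Epi q := hS.epi_kernelLift
  let σ : kernel S.g ⟶ S.X₁ := Projective.factorThru (𝟙 _) q
  have hσ : σ ≫ q = 𝟙 _ := Projective.factorThru_comp _ _
  -- The complement of the idempotent q ≫ σ; its image is the kernel of `S.f`.
  refine ⟨𝟙 _ - q ≫ σ, by simp [reassoc_of% hσ], ?_, fun h => ?_⟩
  · rw [← hq, Preadditive.sub_comp, Category.assoc, reassoc_of% hσ, Category.id_comp, sub_self]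
  · have : Mono q := mono_of_mono_fac (sub_eq_zero.1 h).symm
    rw [← hq]
    infer_instance

/-- The obstruction to extending φ lies in Ext¹(S.X₃, Y). -/
lemma exists_extension_of_subsingleton_ext [HasExt.{w} A] {S : ShortComplex A}
    (hS : S.ShortExact) {Y : A} (h : Subsingleton (Abelian.Ext.{w} S.X₃ Y 1)) (φ : S.X₁ ⟶ Y) :
    ∃ ψ : S.X₂ ⟶ Y, S.f ≫ ψ = φ := by
  obtain ⟨x, hx⟩ := Abelian.Ext.contravariant_sequence_exact₁ hS Y (Abelian.Ext.mk₀ φ)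
    (add_zero 1) (Subsingleton.elim _ _)
  obtain ⟨ψ, rfl⟩ := Abelian.Ext.homEquiv₀.symm.surjective x
  refine ⟨ψ, Abelian.Ext.homEquiv₀.symm.injective ?_⟩
  simpa using hx

end Abelian

/-! ### Two-term resolutions and Serre duality -/

section Triangulated

variable {k : Type w} [Field k] {C : Type u} [Category.{v} C] [Preadditive C] [Linear k C]
  [HasShift C ℤ] [∀ n : ℤ, (shiftFunctor C n).Additive]

/-- In a 2-Calabi-Yau category, `Ext¹(X, Y) = 0` implies `Ext¹(Y, X) = 0`. -/
lemma IsTwoCalabiYau.subsingleton_hom_shift (hCY : IsTwoCalabiYau k C) {X Y : C}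
    (h : ∀ f : X ⟶ Y⟦(1 : ℤ)⟧, f = 0) : Subsingleton (Y ⟶ X⟦(1 : ℤ)⟧) := by
  obtain ⟨S, ⟨e⟩⟩ := hCY
  refine ⟨fun a b => (S.duality _ _).injective (LinearMap.ext fun u => ?_)⟩
  -- Up to ΣY ≅ S²Y, u : SX → ΣY is the suspension of a map X → SY.
  obtain ⟨v, hv⟩ := (shiftFunctor C (1 : ℤ)).map_surjective
    (u ≫ e.inv.app Y ≫ (shiftFunctorAdd' C (1 : ℤ) 1 2 rfl).hom.app Y)
  have hu : u = 0 := by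
    rw [h v, Functor.map_zero] at hv
    rw [← cancel_mono (e.inv.app Y ≫ (shiftFunctorAdd' C (1 : ℤ) 1 2 rfl).hom.app Y),
      zero_comp, ← hv]
  rw [hu, map_zero, map_zero]

variable [HasZeroObject C] [Pretriangulated C]

lemma IsClusterTilting.eq_zero {T : C} (hT : IsClusterTilting T) {X Y : C} (hX : InAdd T X)
    (hY : InAdd T Y) (f : X ⟶ Y⟦(1 : ℤ)⟧) : f = 0 :=
  hX.hom_ext_from fun _ => (hY.map (shiftFunctor C (1 : ℤ))).eq_zero_of_comp_eq_zero
    (fun _ => hT.rigid.elim _ _) |>.trans comp_zero.symm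

/-- Every object has a two-term resolution by objects of `add T`. -/
lemma IsClusterTilting.exists_triangle (hfin : IsHomFinite k C) (hCY : IsTwoCalabiYau k C)
    {T : C} (hT : IsClusterTilting T) (M : C) :
    ∃ (T₁ T₀ : C) (f : T₁ ⟶ T₀) (g : T₀ ⟶ M) (h : M ⟶ T₁⟦(1 : ℤ)⟧),
      InAdd T T₁ ∧ InAdd T T₀ ∧ Triangle.mk f g h ∈ distTriang C := by
  have := hfin T M
  let b := Module.finBasis k (T ⟶ M)
  let n := Module.finrank k (T ⟶ M)
  -- A basis of Hom(T, M) makes every T → M factor through g. Hence Hom(T, ST₁) = 0, and the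
  -- Calabi–Yau property gives Hom(T₁, ST) = 0.
  let g : (⨁ fun _ : Fin n => T) ⟶ M := biproduct.desc b
  obtain ⟨T₁, f, h, mem⟩ := distinguished_cocone_triangle₁ g
  have hg (x : T ⟶ M) : x ≫ h = 0 := by
    have hgh : g ≫ h = 0 := comp_distTriang_mor_zero₂₃ _ mem
    have hx : x = biproduct.lift (fun j => b.repr x j • 𝟙 T) ≫ g := by
      simp [g, n, biproduct.lift_desc]
    rw [hx, Category.assoc, hgh, comp_zero]
  refine ⟨T₁, _, f, g, h, hT.mem_add _ (hCY.subsingleton_hom_shift fun x => ?_),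
    inAdd_biproduct T n, mem⟩
  obtain ⟨y, rfl⟩ := Triangle.coyoneda_exact₁ _ mem x
    (hT.eq_zero (inAdd_self T) (inAdd_biproduct T n) _)
  exact hg y

variable {T M T₁ T₀ : C} {f : T₁ ⟶ T₀} {g : T₀ ⟶ M} {h : M ⟶ T₁⟦(1 : ℤ)⟧}

/-- Applying `Hom(T, -)` to a two-term resolution of `M` by objects of `add T` gives a projective
resolution of `Hom(T, M)`, if the latter has projective dimension at most one and `M` has no
summands in `add ST`. -/
lemma IsClusterTilting.shortExact [IsIdempotentComplete C] (hT : IsClusterTilting T)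
    (h₁ : InAdd T T₁) (h₀ : InAdd T T₀) (mem : Triangle.mk f g h ∈ distTriang C)
    (hM : HasNoSummandInAdd (T⟦(1 : ℤ)⟧) M)
    (hpd : HasProjectiveDimensionLE ((preadditiveCoyonedaObj T).obj M) 1) :
    ∃ zero, (ShortComplex.mk ((preadditiveCoyonedaObj T).map f)
      ((preadditiveCoyonedaObj T).map g) zero).ShortExact := by
  have hfg : f ≫ g = 0 := comp_distTriang_mor_zero₁₂ _ mem
  have zero : (preadditiveCoyonedaObj T).map f ≫ (preadditiveCoyonedaObj T).map g = 0 := by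
    rw [← Functor.map_comp, hfg, Functor.map_zero]
  let S := ShortComplex.mk _ _ zero
  have hS : S.Exact := (S.moduleCat_exact_iff).2 fun (x : T ⟶ T₀) hx => by
    obtain ⟨y, hy⟩ := Triangle.coyoneda_exact₂ _ mem x hx
    exact ⟨y, hy.symm⟩
  have : Epi S.g := (ModuleCat.epi_iff_surjective _).2 fun (x : T ⟶ M) => by
    obtain ⟨y, hy⟩ := Triangle.coyoneda_exact₃ _ mem x (hT.eq_zero (inAdd_self T) h₁ _)
    exact ⟨y, hy.symm⟩
  have : Projective S.X₂ := (h₀.map (preadditiveCoyonedaObj T)).projective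
  obtain ⟨φ, hφ, hφf, hmono⟩ := exists_idempotent_of_hasProjectiveDimensionLE_one S hS hpd
  obtain ⟨e, rfl⟩ := h₁.preadditiveCoyonedaObj_map_surjective φ
  have he : e ≫ e = e := h₁.preadditiveCoyonedaObj_map_injective (by rw [Functor.map_comp, hφ])
  have hef : e ≫ f = 0 := h₁.preadditiveCoyonedaObj_map_injective
    (by rw [Functor.map_comp, Functor.map_zero]; exact hφf)
  obtain ⟨T', i, r, hir, hri⟩ := IsIdempotentComplete.idempotents_split T₁ e he
  have hif : i ≫ f = 0 := by
    rw [← Category.id_comp f, ← Category.id_comp i, ← hir, Category.assoc, Category.assoc,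
      Category.id_comp, reassoc_of% hri, hef, comp_zero]
  -- Since i ≫ f = 0, the suspension of i factors through h, making ST' a retract of M.
  obtain ⟨s, hs⟩ : ∃ s : T'⟦(1 : ℤ)⟧ ⟶ M, i⟦(1 : ℤ)⟧' = s ≫ h :=
    Triangle.coyoneda_exact₁ _ mem (i⟦(1 : ℤ)⟧') (by
      change i⟦(1 : ℤ)⟧' ≫ f⟦(1 : ℤ)⟧' = 0
      rw [← Functor.map_comp, hif, Functor.map_zero])
  have hz : IsZero (T'⟦(1 : ℤ)⟧) := hM _
    ⟨⟨s, h ≫ r⟦(1 : ℤ)⟧', by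
      rw [← Category.assoc, ← hs, ← Functor.map_comp, hir, CategoryTheory.Functor.map_id]⟩⟩
    ((h₁.of_retract ⟨i, r, hir⟩).map (shiftFunctor C (1 : ℤ)))
  have hr : r = 0 := (shiftFunctor C (1 : ℤ)).map_injective (hz.eq_of_tgt _ _)
  have : Mono S.f := hmono (by rw [← hri, hr, zero_comp, Functor.map_zero])
  exact ⟨zero, { exact := hS }⟩

/-- Under the hypotheses of `IsClusterTilting.shortExact`, if moreover
`Ext¹(Hom(T, M), Hom(T, N)) = 0`, morphisms `M ⟶ SN` factoring through `add ST` vanish. -/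
lemma IsClusterTilting.comp_shift_map_eq_zero [IsIdempotentComplete C] (hT : IsClusterTilting T)
    (h₁ : InAdd T T₁) (h₀ : InAdd T T₀) (mem : Triangle.mk f g h ∈ distTriang C)
    (hM : HasNoSummandInAdd (T⟦(1 : ℤ)⟧) M)
    (hpd : HasProjectiveDimensionLE ((preadditiveCoyonedaObj T).obj M) 1) {N : C}
    (hMN : Subsingleton (Abelian.Ext ((preadditiveCoyonedaObj T).obj M)
      ((preadditiveCoyonedaObj T).obj N) 1))
    {U : C} (hU : InAdd T U) (a : M ⟶ U⟦(1 : ℤ)⟧) (b : U ⟶ N) : a ≫ b⟦(1 : ℤ)⟧' = 0 := by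
  obtain ⟨zero, hS⟩ := hT.shortExact h₁ h₀ mem hM hpd
  obtain ⟨c, rfl⟩ : ∃ c : T₁⟦(1 : ℤ)⟧ ⟶ U⟦(1 : ℤ)⟧, a = h ≫ c :=
    Triangle.yoneda_exact₃ _ mem a (hT.eq_zero h₀ hU _)
  obtain ⟨c, rfl⟩ := (shiftFunctor C (1 : ℤ)).map_surjective c
  obtain ⟨ψ, hψ⟩ := exists_extension_of_subsingleton_ext hS hMN
    ((preadditiveCoyonedaObj T).map (c ≫ b))
  obtain ⟨d, rfl⟩ := h₀.preadditiveCoyonedaObj_map_surjective ψ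
  have hd : f ≫ d = c ≫ b :=
    h₁.preadditiveCoyonedaObj_map_injective (by rw [Functor.map_comp]; exact hψ)
  have hhf : h ≫ f⟦(1 : ℤ)⟧' = 0 := comp_distTriang_mor_zero₃₁ _ mem
  rw [Category.assoc, ← Functor.map_comp, ← hd, Functor.map_comp, reassoc_of% hhf, zero_comp]

/-- A morphism `M ⟶ SN` vanishes as soon as all morphisms `M ⟶ SN` and `N ⟶ SM` factoring through
`add ST` do. -/
lemma IsTwoCalabiYau.subsingleton_hom_shift_of_factors (hCY : IsTwoCalabiYau k C) {N : C}
    (h₁ : InAdd T T₁) (h₀ : InAdd T T₀) (mem : Triangle.mk f g h ∈ distTriang C)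
    (hMN : ∀ {U : C}, InAdd T U → ∀ (a : M ⟶ U⟦(1 : ℤ)⟧) (b : U ⟶ N), a ≫ b⟦(1 : ℤ)⟧' = 0)
    (hNM : ∀ {U : C}, InAdd T U → ∀ (a : N ⟶ U⟦(1 : ℤ)⟧) (b : U ⟶ M), a ≫ b⟦(1 : ℤ)⟧' = 0) :
    Subsingleton (ShiftedHom M N (1 : ℤ)) := by
  refine subsingleton_of_forall_eq 0 fun (w : M ⟶ N⟦(1 : ℤ)⟧) => ?_
  obtain ⟨S, ⟨e⟩⟩ := hCY
  have hgw : g ≫ w = 0 := by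
    -- Test g ≫ w against u : SN → ΣT₀; naturality moves g onto u, where `hNM` applies.
    refine (S.duality _ _).injective (LinearMap.ext fun u => ?_)
    let σ := shiftFunctorAdd' C (1 : ℤ) 1 2 rfl
    obtain ⟨v, hv⟩ := (shiftFunctor C (1 : ℤ)).map_surjective (u ≫ e.inv.app T₀ ≫ σ.hom.app T₀)
    have hu : u = (v⟦(1 : ℤ)⟧') ≫ σ.inv.app T₀ ≫ e.hom.app T₀ := by simp [hv]
    have hug : u ≫ S.functor.map g = 0 := by
      have h₁ := e.hom.naturality g
      have h₂ : _ = σ.inv.app T₀ ≫ _ := σ.inv.naturality g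
      have h₃ := congrArg (shiftFunctor C (1 : ℤ)).map (hNM h₀ v g)
      rw [Functor.map_comp, Functor.map_zero] at h₃
      rw [hu, Category.assoc, Category.assoc, ← h₁, ← reassoc_of% h₂]
      change _ ≫ (g⟦(1 : ℤ)⟧')⟦(1 : ℤ)⟧' ≫ _ = 0
      rw [reassoc_of% h₃, zero_comp]
    have := S.naturality g (𝟙 _) w u
    rw [Category.comp_id, Category.id_comp, hug, map_zero] at this
    rw [this, map_zero, LinearMap.zero_apply]
  obtain ⟨y, hy⟩ := Triangle.yoneda_exact₃ _ mem w hgw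
  obtain ⟨b, rfl⟩ := (shiftFunctor C (1 : ℤ)).map_surjective y
  exact hy.trans (hMN h₁ h b)

end Triangulated

end TwoCY

/-- `preadditiveCoyonedaObj T` is the functor `F = Hom(T, -)` with values in right modules over
`Γ = End T`, i.e. left modules over `(End T)ᵐᵒᵖ`; `ShiftedHom M N 1` is `Ext¹(M, N)` in `C`. -/
theorem proposition3p2 {k : Type w} [Field k] [IsAlgClosed k]
    {C : Type u} [Category.{v} C] [Preadditive C]
    [Linear k C] [HasZeroObject C]
    [HasShift C ℤ]
    [∀ n : ℤ, (shiftFunctor C n).Additive]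
    [∀ n : ℤ, (shiftFunctor C n).Linear k]
    [Pretriangulated C] [IsTriangulated C]
    [IsIdempotentComplete C]
    (hKS : TwoCY.IsKrullSchmidt C) (hfin : TwoCY.IsHomFinite k C)
    (hCY : TwoCY.IsTwoCalabiYau k C)
    (T : C) (hT : TwoCY.IsClusterTilting T) (M N : C)
    (hM : TwoCY.HasNoSummandInAdd (T⟦(1 : ℤ)⟧) M)
    (hN : TwoCY.HasNoSummandInAdd (T⟦(1 : ℤ)⟧) N)
    (hpdM : HasProjectiveDimensionLE
      ((preadditiveCoyonedaObj T).obj M) 1)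
    (hpdN : HasProjectiveDimensionLE
      ((preadditiveCoyonedaObj T).obj N) 1)
    (hMN : Subsingleton (Abelian.Ext
      ((preadditiveCoyonedaObj T).obj M)
      ((preadditiveCoyonedaObj T).obj N) 1))
    (hNM : Subsingleton (Abelian.Ext
      ((preadditiveCoyonedaObj T).obj N)
      ((preadditiveCoyonedaObj T).obj M) 1)) :
    Subsingleton (ShiftedHom M N (1 : ℤ)) ∧
      Subsingleton (ShiftedHom N M (1 : ℤ)) := by
  obtain ⟨M₁, M₀, f, g, h, hM₁, hM₀, hfgh⟩ := hT.exists_triangle hfin hCY M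
  obtain ⟨N₁, N₀, f', g', h', hN₁, hN₀, hfgh'⟩ := hT.exists_triangle hfin hCY N
  have zMN {U : C} := hT.comp_shift_map_eq_zero hM₁ hM₀ hfgh hM hpdM hMN (U := U)
  have zNM {U : C} := hT.comp_shift_map_eq_zero hN₁ hN₀ hfgh' hN hpdN hNM (U := U)
  exact ⟨hCY.subsingleton_hom_shift_of_factors hM₁ hM₀ hfgh zMN zNM,
    hCY.subsingleton_hom_shift_of_factors hN₁ hN₀ hfgh' zNM zMN⟩
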